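/- Let $f$ be a transcendental entire function, $f^{\circ n}$ its $n$-th iterate, $M(r)=\max_{|z|=r}|f(z)|$ its maximal modulus function and $M^{\circ n}$ the $n$-th iterate of $M$. The fast escaping set of $f$ is $$A(f)=\{z\in\mathbb C:\ \text{there is } \ell\in\mathbb N \text{ such that } |f^{\circ(n+\ell)}(z)|\ge M^{\circ n}(R)\text{ for all } n\in\mathbb N\},$$ where $R>0$ is any constant with $M^{\circ n}(R)\to\infty$ as $n\to\infty$ (the set does not depend on the choice of such an $R$), $0\in\mathbb N$, and $A(f)^c=\mathbb C\setminus A(f)$. Let $\mathrm{Area}$ denote planar Lebesgue measure. **Theorem 1.2.** Let $\alpha,\beta\in\mathbb C$ with $\alpha\ne0$, let $f(z)=\alpha\sin(z+\beta)$, and let $S=\{z: a\le \mathrm{Re}\,z\le a+2\pi\}$, $a\in\mathbb R$, be any vertical strip of width $2\pi$. Then $$\mathrm{Area}(S\cap A(f)^c)\le(4\pi+4r)\left(x^*+r+8c\,e^{4-x^*/2}\,\frac{r}{1-e^{-r/2}}\right),$$ where $$r=\frac18,\qquad c=\frac{536\sqrt2}{|\alpha|}+\frac1{|\alpha|^2},$$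 $$x^*=\max\left\{\log\left(1+\frac{18K}{|\alpha|}\right),\ \log\left(\frac{8(K+1)}{|\alpha|}\right),\ 6\log2,\ 12+2\log c\right\},\qquad K=\max\left\{\frac{|\alpha|}2,|\beta|\right\}.$$ In particular, if $f(z)=\sin z$ or $f(z)=\cos z$, then $\mathrm{Area}(S\cap A(f)^c)<361$ for every vertical strip $S$ of width $2\pi$. -/

import Mathlib

open MeasureTheory Filter Topology

/-- The maximal modulus function `M(r, f) = max_{|z| = r} |f z|`.  For continuous `f` and `r ≥ 0`
the circle is compact and non-empty, so the supremum is a maximum. -/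
noncomputable def maxModulus (f : ℂ → ℂ) (r : ℝ) : ℝ :=
  sSup ((fun z : ℂ => ‖f z‖) '' Metric.sphere (0 : ℂ) r)

/-- `R > 0` is admissible for `f` if the iterates `M^n(R)` of the maximal modulus function
tend to infinity. -/
def IsAdmissibleRadius (f : ℂ → ℂ) (R : ℝ) : Prop :=
  0 < R ∧ Tendsto (fun n : ℕ => (maxModulus f)^[n] R) atTop atTop

/-- The fast escaping set of `f`, formed with the radius `R`: the points `z` for which there is
`ℓ` with `|f^(n+ℓ) z| ≥ M^n(R)` for all `n`.  For a transcendental entire function it does not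
depend on the choice of the admissible radius `R`. -/
def fastEscapingSet (f : ℂ → ℂ) (R : ℝ) : Set ℂ :=
  {z | ∃ l : ℕ, ∀ n : ℕ, (maxModulus f)^[n] R ≤ ‖f^[n + l] z‖}

/-- The closed vertical strip of width `2π` whose left edge has abscissa `a`. -/
def verticalStrip (a : ℝ) : Set ℂ :=
  {z | a ≤ z.re ∧ z.re ≤ a + 2 * Real.pi}

/-!
Write `f z = α sin (z + β)` and call `z` high if `|im (z + β)| > x`, for a height `x` at which `f`
is steep (`IsSteepHeight`).  The part of a strip of width `2π` that is not high has area `4πx`, so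
the point is to show that almost all of the high part, up to area `6/5`, is fast escaping; the
stated bound exceeds `4πx + 6/5`.

The derivative satisfies `f'² = α² cos² (z + β) = α² - f²`, so the Jacobian `|f'(z)|²` depends only
on `f z`, and it is at least `|f z|² / 2` at high points.  Since the sine is injective on each half
of a period strip, the change of variables formula bounds the area of the high points of a period
strip mapped into `E` by `ν E`, where `ν` has density `4 / |ζ|²` on the far region that contains
all images of high points (`volume_inter_preimage_le`).  This needs no control of distortion and
can be iterated: cutting the plane into vertical slices and summing the supremum of the density
over the slices gives `ν {z high | f z ∈ E} ≤ ν E / 2` (`farMeasure_inter_preimage_le`).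

A point `ζ` is low if `|im (ζ + β)| ≤ √|ζ| / 10`.  The low region is thin, so `ν` gives it mass at
most `3/10` (`farMeasure_lowRegion_le`), and by the geometric series the high points of a period
strip whose orbit ever becomes low have area at most `3/5`.  For every other high point the heights
`tₙ` of the orbit satisfy `tₙ₊₁ ≥ 10 exp (tₙ / 4)`.  As the maximal modulus is at most
`‖α‖ exp (‖β‖ + r)`, the sequence `tₙ / 8` eventually outgrows its iterates from any starting
radius, so such a point is fast escaping (`mem_fastEscapingSet_sineMap`).
-/

/-! ### Regions of the plane and the reference measure -/

/-- The map `z ↦ α sin (z + β)`. -/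
noncomputable def sineMap (α β : ℂ) (z : ℂ) : ℂ := α * Complex.sin (z + β)

/-- The points at height more than `x` above or below the horizontal line `im z = -im β`.  Heights
are measured from this line because the growth of `α sin (z + β)` depends on `|im (z + β)|`. -/
def highRegion (β : ℂ) (x : ℝ) : Set ℂ := {z | x < |(z + β).im|}

/-- The points far from `0`, both absolutely and relative to the parameters.  It contains the image
of `highRegion β x` when the height `x` is steep. -/
def farRegion (K : ℝ) : Set ℂ := {ζ | 10 ^ 4 ≤ ‖ζ‖ ∧ 9 * K ≤ ‖ζ‖}

/-- The measure with density `4 / |ζ|²` on `farRegion K`.  Up to a constant it dominates the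
push-forward of area on a period strip under `sineMap`, since `|f'|² = |α² - f²|` is
comparable to `|f|²` there. -/
noncomputable def farMeasure (K : ℝ) : Measure ℂ :=
  (volume.restrict (farRegion K)).withDensity fun ζ => ENNReal.ofReal (4 / ‖ζ‖ ^ 2)

/-- The points whose height is at most `√|ζ| / 10`.  A high point is lost as soon as its image
falls in this region. -/
def lowRegion (β : ℂ) : Set ℂ := {ζ | |(ζ + β).im| ≤ √‖ζ‖ / 10}

/-- A height `x` above which `sineMap α β` expands strongly and takes values of modulus much larger
than the parameters.  Here `K` stands for any common bound of `‖α‖ / 2` and `‖β‖`. -/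
structure IsSteepHeight (α β : ℂ) (K x : ℝ) : Prop where
  one_le : 1 ≤ x
  norm_coeff_le : ‖α‖ ≤ 2 * K
  norm_shift_le : ‖β‖ ≤ K
  steep : 4 * 10 ^ 4 ≤ ‖α‖ * Real.exp (x / 2)
  dominates : 18 * K ≤ ‖α‖ * (Real.exp x - 1)

theorem continuous_sineMap (α β : ℂ) : Continuous (sineMap α β) := by
  unfold sineMap; fun_prop

theorem measurableSet_highRegion (β : ℂ) (x : ℝ) : MeasurableSet (highRegion β x) :=
  measurableSet_lt (by fun_prop) (by fun_prop)

theorem measurableSet_farRegion (K : ℝ) : MeasurableSet (farRegion K) :=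
  (measurableSet_le measurable_const measurable_norm).inter
    (measurableSet_le measurable_const measurable_norm)

theorem measurableSet_lowRegion (β : ℂ) : MeasurableSet (lowRegion β) :=
  measurableSet_le (by fun_prop) (by fun_prop)

theorem measurableSet_preimage_sineMap (α β : ℂ) {E : Set ℂ} (hE : MeasurableSet E) :
    MeasurableSet (sineMap α β ⁻¹' E) :=
  (continuous_sineMap α β).measurable hE

theorem farMeasure_apply (K : ℝ) {E : Set ℂ} (hE : MeasurableSet E) :
    farMeasure K E = ∫⁻ ζ in E ∩ farRegion K, ENNReal.ofReal (4 / ‖ζ‖ ^ 2) := by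
  rw [farMeasure, withDensity_apply _ hE, Measure.restrict_restrict hE]

/-! ### Growth and expansion at steep heights -/

theorem sinh_abs_im_le_norm_sin (w : ℂ) :
    (Real.exp |w.im| - Real.exp (-|w.im|)) / 2 ≤ ‖Complex.sin w‖ := by
  have h1 : ‖Complex.exp (-w * Complex.I)‖ = Real.exp w.im := by
    simp [Complex.norm_exp]
  have h2 : ‖Complex.exp (w * Complex.I)‖ = Real.exp (-w.im) := by
    simp [Complex.norm_exp]
  have h3 : ‖Complex.sin w‖ =
      ‖Complex.exp (-w * Complex.I) - Complex.exp (w * Complex.I)‖ / 2 := by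
    simp [Complex.sin]
  rw [h3]
  rcases abs_cases w.im with ⟨h, -⟩ | ⟨h, -⟩
  · have := norm_sub_norm_le (Complex.exp (-w * Complex.I)) (Complex.exp (w * Complex.I))
    rw [h1, h2] at this
    rw [h]; linarith
  · have := norm_sub_norm_le (Complex.exp (w * Complex.I)) (Complex.exp (-w * Complex.I))
    rw [h1, h2, norm_sub_rev] at this
    rw [h, neg_neg]; linarith

namespace IsSteepHeight

variable {α β : ℂ} {K x : ℝ}

theorem norm_sineMap_ge (h : IsSteepHeight α β K x) {z : ℂ} (hz : z ∈ highRegion β x) :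
    10 ^ 4 * Real.exp (|(z + β).im| / 2) ≤ ‖sineMap α β z‖ := by
  have hz' : x < |(z + β).im| := hz
  set t := |(z + β).im|
  have h1 := sinh_abs_im_le_norm_sin (z + β)
  have h2 : Real.exp t = Real.exp (t / 2) * Real.exp (t / 2) := by
    rw [← Real.exp_add]; ring_nf
  have h3 : Real.exp (x / 2) ≤ Real.exp (t / 2) := Real.exp_le_exp.2 (by linarith)
  have h4 : Real.exp (-t) ≤ 1 := Real.exp_le_one_iff.2 (by simp [t])
  have h5 : 2 ≤ Real.exp t := by
    have := Real.add_one_le_exp t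
    linarith [h.one_le]
  have h6 : Real.exp t / 4 ≤ ‖Complex.sin (z + β)‖ := by linarith
  have h7 : 4 * 10 ^ 4 ≤ ‖α‖ * Real.exp (t / 2) :=
    h.steep.trans (by gcongr)
  rw [sineMap, norm_mul]
  calc 10 ^ 4 * Real.exp (t / 2) ≤ (‖α‖ * Real.exp (t / 2)) / 4 * Real.exp (t / 2) := by
        gcongr; linarith
    _ = ‖α‖ * (Real.exp t / 4) := by rw [h2]; ring
    _ ≤ _ := by gcongr

theorem sineMap_mem_farRegion (h : IsSteepHeight α β K x) {z : ℂ} (hz : z ∈ highRegion β x) :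
    sineMap α β z ∈ farRegion K := by
  have hz' : x < |(z + β).im| := hz
  constructor
  · refine le_trans ?_ (h.norm_sineMap_ge hz)
    have : 1 ≤ Real.exp (|(z + β).im| / 2) := Real.one_le_exp (by positivity)
    linarith
  · have h1 := sinh_abs_im_le_norm_sin (z + β)
    have h4 : Real.exp (-|(z + β).im|) ≤ 1 := Real.exp_le_one_iff.2 (by simp)
    have h3 : Real.exp x ≤ Real.exp |(z + β).im| := Real.exp_le_exp.2 hz'.le
    have h6 : (Real.exp x - 1) / 2 ≤ ‖Complex.sin (z + β)‖ := by linarith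
    rw [sineMap, norm_mul]
    have := mul_le_mul_of_nonneg_left h6 (norm_nonneg α)
    linarith [h.dominates]

theorem nonneg (h : IsSteepHeight α β K x) : 0 ≤ K := (norm_nonneg β).trans h.norm_shift_le

theorem height_le_norm (h : IsSteepHeight α β K x) {ζ : ℂ} (hζ : ζ ∈ farRegion K) :
    |(ζ + β).im| ≤ 2 * ‖ζ‖ := by
  have h1 : |(ζ + β).im| ≤ ‖ζ‖ + ‖β‖ := (Complex.abs_im_le_norm _).trans (norm_add_le _ _)
  linarith [hζ.2, h.norm_shift_le, h.nonneg]

/-- The derivative satisfies `f'(z)² = α² - f(z)²`, so its modulus is determined by the value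
`f(z)` alone; this is what makes the transfer operator explicit. -/
theorem half_norm_sq_le_norm_deriv_sq (h : IsSteepHeight α β K x) {z : ℂ}
    (hz : z ∈ highRegion β x) :
    ‖sineMap α β z‖ ^ 2 / 2 ≤ ‖α * Complex.cos (z + β)‖ ^ 2 := by
  have hfar := (h.sineMap_mem_farRegion hz).2
  have h1 : (α * Complex.cos (z + β)) ^ 2 = α ^ 2 - sineMap α β z ^ 2 := by
    rw [sineMap]
    linear_combination α ^ 2 * Complex.sin_sq_add_cos_sq (z + β)
  rw [← norm_pow (α * _), h1]
  have h2 := norm_sub_norm_le (sineMap α β z ^ 2) (α ^ 2)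
  rw [norm_sub_rev, norm_pow, norm_pow] at h2
  have h3 : ‖α‖ ≤ 2 * (‖sineMap α β z‖ / 9) := by linarith [h.norm_coeff_le]
  nlinarith [norm_nonneg α, norm_nonneg (sineMap α β z)]

/-- If the image of a high point is not low, then its height is exponential in the old one. -/
theorem exp_le_height_of_notMem_lowRegion (h : IsSteepHeight α β K x) {z : ℂ} (hz : z ∈ highRegion β x)
    (hlow : sineMap α β z ∉ lowRegion β) :
    10 * Real.exp (|(z + β).im| / 4) ≤ |(sineMap α β z + β).im| := by
  have h1 : √‖sineMap α β z‖ / 10 < |(sineMap α β z + β).im| := not_le.1 hlow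
  have h2 : 100 * Real.exp (|(z + β).im| / 4) ≤ √‖sineMap α β z‖ := by
    apply Real.le_sqrt_of_sq_le
    refine le_trans (le_of_eq ?_) (h.norm_sineMap_ge hz)
    rw [mul_pow, ← Real.exp_nat_mul]
    push_cast; ring_nf
  linarith

theorem sineMap_mem_highRegion (h : IsSteepHeight α β K x) {z : ℂ} (hz : z ∈ highRegion β x)
    (hlow : sineMap α β z ∉ lowRegion β) : sineMap α β z ∈ highRegion β x := by
  have h1 := h.exp_le_height_of_notMem_lowRegion hz hlow
  have h2 := Real.add_one_le_exp (|(z + β).im| / 4)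
  have hz' : x < |(z + β).im| := hz
  change x < |(sineMap α β z + β).im|
  linarith [h.one_le]

end IsSteepHeight

/-! ### The transfer operator: areas of preimages -/

theorem abs_det_real_smul_one (c : ℂ) :
    |((c • (1 : ℂ →L[ℝ] ℂ))).det| = ‖c‖ ^ 2 := by
  have : (c • (1 : ℂ →L[ℝ] ℂ)).det = Algebra.norm ℝ c := by
    rw [Algebra.norm_apply]
    rfl
  rw [this, Algebra.norm_complex_apply, Complex.normSq_eq_norm_sq, abs_of_nonneg (by positivity)]

/-- On a half-strip of width at most `2π` on one side of the line `im (z + β) = 0` the map is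
injective; the sign of `σ` selects the side. -/
theorem injOn_sineMap_halfPlane {J : Set ℝ} (hJ : ∀ s ∈ J, ∀ t ∈ J, |s - t| < 2 * Real.pi) (α β : ℂ)
    (hα : α ≠ 0) (σ : ℝ) :
    Set.InjOn (sineMap α β) {z | z.re ∈ J ∧ 0 < σ * (z + β).im} := by
  rintro z ⟨hz, hz'⟩ w ⟨hw, hw'⟩ hzw
  have h1 : Complex.sin (z + β) = Complex.sin (w + β) := mul_left_cancel₀ hα hzw
  obtain ⟨k, hk | hk⟩ := Complex.sin_eq_sin_iff.1 h1
  · have hre : w.re - z.re = 2 * k * Real.pi := by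
      have := congrArg Complex.re hk
      simp at this
      linarith
    have hlt := hJ _ hw _ hz
    rw [hre, abs_mul, abs_mul, abs_two, abs_of_pos Real.pi_pos] at hlt
    have : |(k : ℝ)| < 1 := by
      by_contra! hcon
      nlinarith [Real.pi_pos]
    have hk0 : k = 0 := by
      rw [← Int.abs_lt_one_iff]
      exact_mod_cast this
    subst hk0
    simpa using hk.symm
  -- The other solutions are reflections of `z`, and lie on the opposite side of the line.
  · have him : (w + β).im = -(z + β).im := by
      have := congrArg Complex.im hk
      simpa using this
    rw [him] at hw'
    linarith

theorem volume_inter_le_half {α β : ℂ} {K x : ℝ} (h : IsSteepHeight α β K x) {J : Set ℝ}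
    (hJm : MeasurableSet J) (hJ : ∀ s ∈ J, ∀ t ∈ J, |s - t| < 2 * Real.pi) {E : Set ℂ}
    (hE : MeasurableSet E) (σ : ℝ) :
    volume ({z : ℂ | z.re ∈ J ∧ 0 < σ * (z + β).im} ∩ (highRegion β x ∩ sineMap α β ⁻¹' E)) ≤
      ∫⁻ ζ in E ∩ farRegion K, ENNReal.ofReal (2 / ‖ζ‖ ^ 2) := by
  have hα : α ≠ 0 := by
    rintro rfl
    have := h.steep
    norm_num at this
  set s := {z : ℂ | z.re ∈ J ∧ 0 < σ * (z + β).im} ∩ (highRegion β x ∩ sineMap α β ⁻¹' E)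
    with hs
  have hupper : MeasurableSet {z : ℂ | 0 < σ * (z + β).im} :=
    measurableSet_lt (by fun_prop) (by fun_prop)
  have hsm : MeasurableSet s :=
    ((Complex.measurable_re hJm).inter hupper).inter
      ((measurableSet_highRegion β x).inter (measurableSet_preimage_sineMap α β hE))
  have hderiv : ∀ z ∈ s, HasFDerivWithinAt (sineMap α β)
      ((α * Complex.cos (z + β)) • (1 : ℂ →L[ℝ] ℂ)) s z := fun z _ => by
    have h1 : HasDerivAt (sineMap α β) (α * Complex.cos (z + β)) z := by
      have := ((Complex.hasDerivAt_sin (z + β)).comp_add_const z β).const_mul α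
      exact this
    exact h1.complexToReal_fderiv.hasFDerivWithinAt
  have hinj : Set.InjOn (sineMap α β) s :=
    (injOn_sineMap_halfPlane hJ α β hα σ).mono Set.inter_subset_left
  calc volume s = ∫⁻ _ in s, 1 := by simp
    _ ≤ ∫⁻ z in s, ENNReal.ofReal |((α * Complex.cos (z + β)) • (1 : ℂ →L[ℝ] ℂ)).det| *
          ENNReal.ofReal (2 / ‖sineMap α β z‖ ^ 2) := by
        refine setLIntegral_mono' hsm fun z hz => ?_
        have hz' := h.half_norm_sq_le_norm_deriv_sq hz.2.1
        have hpos : 0 < ‖sineMap α β z‖ := by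
          linarith [(h.sineMap_mem_farRegion hz.2.1).1]
        rw [abs_det_real_smul_one, ← ENNReal.ofReal_mul (by positivity),
          ← ENNReal.ofReal_one]
        apply ENNReal.ofReal_le_ofReal
        rw [mul_div_assoc', le_div_iff₀ (by positivity)]
        linarith
    _ = ∫⁻ ζ in sineMap α β '' s, ENNReal.ofReal (2 / ‖ζ‖ ^ 2) :=
        (lintegral_image_eq_lintegral_abs_det_fderiv_mul volume hsm hderiv hinj
          fun ζ => ENNReal.ofReal (2 / ‖ζ‖ ^ 2)).symm
    _ ≤ _ := by
        refine lintegral_mono_set ?_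
        rintro _ ⟨z, hz, rfl⟩
        exact ⟨hz.2.2, h.sineMap_mem_farRegion hz.2.1⟩

/-- The area of the high points of a strip of width at most `2π` that are mapped into `E` is at
most the reference measure of `E`. -/
theorem volume_inter_preimage_le {α β : ℂ} {K x : ℝ} (h : IsSteepHeight α β K x) {J : Set ℝ}
    (hJm : MeasurableSet J) (hJ : ∀ s ∈ J, ∀ t ∈ J, |s - t| < 2 * Real.pi) {E : Set ℂ}
    (hE : MeasurableSet E) :
    volume ({z : ℂ | z.re ∈ J} ∩ (highRegion β x ∩ sineMap α β ⁻¹' E)) ≤ farMeasure K E := by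
  have hsub : {z : ℂ | z.re ∈ J} ∩ (highRegion β x ∩ sineMap α β ⁻¹' E) ⊆
      ({z : ℂ | z.re ∈ J ∧ 0 < 1 * (z + β).im} ∩ (highRegion β x ∩ sineMap α β ⁻¹' E)) ∪
      ({z : ℂ | z.re ∈ J ∧ 0 < (-1) * (z + β).im} ∩ (highRegion β x ∩ sineMap α β ⁻¹' E)) := by
    rintro z ⟨hz, hz'⟩
    have h0 : x < |(z + β).im| := hz'.1
    have h1 : (z + β).im ≠ 0 := by
      intro h2
      rw [h2, abs_zero] at h0
      linarith [h.one_le]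
    rcases lt_or_gt_of_ne h1 with h2 | h2
    · exact Or.inr ⟨⟨hz, by linarith⟩, hz'⟩
    · exact Or.inl ⟨⟨hz, by linarith⟩, hz'⟩
  refine (measure_mono hsub).trans ((measure_union_le _ _).trans
    ((add_le_add (volume_inter_le_half h hJm hJ hE 1)
      (volume_inter_le_half h hJm hJ hE (-1))).trans (le_of_eq ?_)))
  rw [farMeasure_apply K hE, ← lintegral_add_left (by fun_prop)]
  congr 1 with ζ
  rw [← ENNReal.ofReal_add (by positivity) (by positivity)]
  ring_nf

/-! ### Summation over unit slices -/

theorem one_div_mul_sqrt_le_telescope {N : ℝ} (hN : 10 ^ 4 ≤ N) :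
    1 / (N * √N) ≤ 3 * (1 / √N - 1 / √(N + 1)) := by
  have hs : 100 ≤ √N := Real.le_sqrt_of_sq_le (by linarith)
  have hs2 : √N ^ 2 = N := Real.sq_sqrt (by linarith)
  have hu2 : √(N + 1) ^ 2 = N + 1 := Real.sq_sqrt (by linarith)
  have hus : √N ≤ √(N + 1) := Real.sqrt_le_sqrt (by linarith)
  set s := √N
  set u := √(N + 1)
  have hu : u ≤ s + 1 := by nlinarith
  have hkey : 1 / s - 1 / u = 1 / (s * u * (u + s)) := by
    have : 0 < s := by linarith
    have : 0 < u := by linarith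
    field_simp
    linear_combination hu2 - hs2
  rw [hkey, ← hs2, mul_one_div, div_le_div_iff₀ (by positivity) (by positivity)]
  have h1 : u * (u + s) ≤ 3 * s ^ 2 := by nlinarith
  nlinarith [mul_le_mul_of_nonneg_left h1 (by linarith : 0 ≤ s)]

theorem tsum_one_div_mul_sqrt_le :
    ∑' n : ℕ, ENNReal.ofReal (1 / (((n : ℝ) + 10 ^ 4) * √((n : ℝ) + 10 ^ 4))) ≤
      ENNReal.ofReal (3 / 100) := by
  refine ENNReal.tsum_le_of_sum_range_le fun m => ?_
  rw [← ENNReal.ofReal_sum_of_nonneg fun n _ => by positivity]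
  apply ENNReal.ofReal_le_ofReal
  calc ∑ n ∈ Finset.range m, 1 / (((n : ℝ) + 10 ^ 4) * √((n : ℝ) + 10 ^ 4))
      ≤ ∑ n ∈ Finset.range m, (3 * (1 / √((n : ℝ) + 10 ^ 4)) -
          3 * (1 / √(((n + 1 : ℕ) : ℝ) + 10 ^ 4))) := by
        refine Finset.sum_le_sum fun n _ => ?_
        have := one_div_mul_sqrt_le_telescope (N := (n : ℝ) + 10 ^ 4) (by simp)
        rw [mul_sub] at this
        rwa [show (((n + 1 : ℕ) : ℝ) + 10 ^ 4) = (n : ℝ) + 10 ^ 4 + 1 by push_cast; ring]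
    _ = 3 * (1 / √(((0 : ℕ) : ℝ) + 10 ^ 4)) - 3 * (1 / √((m : ℝ) + 10 ^ 4)) :=
        Finset.sum_range_sub' (fun n : ℕ => 3 * (1 / √((n : ℝ) + 10 ^ 4))) m
    _ ≤ 3 / 100 := by
        have h1 : √(((0 : ℕ) : ℝ) + 10 ^ 4) = 100 := by
          rw [show ((0 : ℕ) : ℝ) + 10 ^ 4 = 100 ^ 2 by norm_num]
          exact Real.sqrt_sq (by norm_num)
        have h2 : 0 ≤ 3 * (1 / √((m : ℝ) + 10 ^ 4)) := by positivity
        rw [h1]; linarith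

/-- The points `z` with `n ≤ |re z| < n + 1`, a union of two vertical strips of width one. -/
def unitSlice (n : ℕ) : Set ℂ := {z | (n : ℝ) ≤ |z.re| ∧ |z.re| < n + 1}

theorem measurableSet_unitSlice (n : ℕ) : MeasurableSet (unitSlice n) :=
  (measurableSet_le measurable_const Complex.measurable_re.abs).inter
    (measurableSet_lt Complex.measurable_re.abs measurable_const)

theorem unitSlice_subset (n : ℕ) :
    unitSlice n ⊆ {z | z.re ∈ Set.Ico (n : ℝ) (n + 1)} ∪ {z | z.re ∈ Set.Ioc (-n - 1 : ℝ) (-n)} := by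
  rintro z ⟨h1, h2⟩
  rcases abs_cases z.re with ⟨h, -⟩ | ⟨h, -⟩
  · exact Or.inl ⟨by linarith, by linarith⟩
  · exact Or.inr ⟨by linarith, by linarith⟩

/-- On the slice with index `n` the density `4 / |ζ|²` is at most `16 / (n + 10⁴)²`, because both
`n` and `10⁴` are lower bounds for `|ζ|`. -/
theorem farMeasure_le_tsum (K : ℝ) {X : Set ℂ} (hX : MeasurableSet X) :
    farMeasure K X ≤ ∑' n : ℕ, ENNReal.ofReal (16 / ((n : ℝ) + 10 ^ 4) ^ 2) *
      volume (X ∩ farRegion K ∩ unitSlice n) := by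
  have hsub : X ⊆ ⋃ n, X ∩ unitSlice n := fun z hz =>
    Set.mem_iUnion.2 ⟨⌊|z.re|⌋₊, hz, Nat.floor_le (abs_nonneg _), Nat.lt_floor_add_one _⟩
  refine (measure_mono hsub).trans ((measure_iUnion_le _).trans (ENNReal.tsum_le_tsum fun n => ?_))
  have hm := hX.inter (measurableSet_unitSlice n)
  rw [farMeasure_apply K hm, Set.inter_right_comm, ← setLIntegral_const]
  refine setLIntegral_mono' ((hX.inter (measurableSet_farRegion K)).inter
    (measurableSet_unitSlice n)) fun ζ hζ => ENNReal.ofReal_le_ofReal ?_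
  have h1 : ((n : ℝ) + 10 ^ 4) / 2 ≤ ‖ζ‖ := by
    linarith [hζ.1.2.1, hζ.2.1, Complex.abs_re_le_norm ζ]
  calc 4 / ‖ζ‖ ^ 2 ≤ 4 / (((n : ℝ) + 10 ^ 4) / 2) ^ 2 := by gcongr
    _ = _ := by field_simp; norm_num

/-- Pulling back by the map, restricted to high points, at least halves the reference measure: each
slice contributes at most `2 · farMeasure K E` times its density bound, and these bounds have a
small sum. -/
theorem farMeasure_inter_preimage_le {α β : ℂ} {K x : ℝ} (h : IsSteepHeight α β K x) {E : Set ℂ}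
    (hE : MeasurableSet E) :
    farMeasure K (highRegion β x ∩ sineMap α β ⁻¹' E) ≤ 2⁻¹ * farMeasure K E := by
  have hX := (measurableSet_highRegion β x).inter (measurableSet_preimage_sineMap α β hE)
  set X := highRegion β x ∩ sineMap α β ⁻¹' E
  have hpi := Real.pi_gt_three
  have hslice : ∀ n : ℕ, volume (X ∩ farRegion K ∩ unitSlice n) ≤ 2 * farMeasure K E := by
    intro n
    have hsub : X ∩ farRegion K ∩ unitSlice n ⊆
        ({z | z.re ∈ Set.Ico (n : ℝ) (n + 1)} ∩ X) ∪
        ({z | z.re ∈ Set.Ioc (-n - 1 : ℝ) (-n)} ∩ X) := by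
      rintro z ⟨⟨hz, -⟩, hn⟩
      exact (unitSlice_subset n hn).imp (fun h => ⟨h, hz⟩) (fun h => ⟨h, hz⟩)
    rw [two_mul]
    refine (measure_mono hsub).trans ((measure_union_le _ _).trans (add_le_add
      (volume_inter_preimage_le h measurableSet_Ico ?_ hE)
      (volume_inter_preimage_le h measurableSet_Ioc ?_ hE))) <;>
    · rintro s ⟨hs, hs'⟩ t ⟨ht, ht'⟩
      rw [abs_lt]
      constructor <;> linarith
  calc farMeasure K X ≤ _ := farMeasure_le_tsum K hX
    _ ≤ ∑' n : ℕ, ENNReal.ofReal (1 / (((n : ℝ) + 10 ^ 4) * √((n : ℝ) + 10 ^ 4))) *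
          farMeasure K E := by
        refine ENNReal.tsum_le_tsum fun n => (mul_le_mul_right (hslice n) _).trans ?_
        rw [← mul_assoc]
        refine mul_le_mul_left ?_ _
        rw [← ENNReal.ofReal_ofNat 2, ← ENNReal.ofReal_mul (by positivity)]
        apply ENNReal.ofReal_le_ofReal
        have hN : (10 : ℝ) ^ 4 ≤ n + 10 ^ 4 := by simp
        generalize (n : ℝ) + 10 ^ 4 = N at hN
        have hs : 100 ≤ √N := Real.le_sqrt_of_sq_le (by linarith)
        have hs2 : √N ^ 2 = N := Real.sq_sqrt (by linarith)
        rw [div_mul_eq_mul_div, div_le_div_iff₀ (by positivity) (by positivity)]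
        have : 32 * √N ≤ N := by nlinarith
        nlinarith
    _ ≤ ENNReal.ofReal (3 / 100) * farMeasure K E := by
        rw [ENNReal.tsum_mul_right]
        exact mul_le_mul_left tsum_one_div_mul_sqrt_le _
    _ ≤ _ := by
        refine mul_le_mul_left ?_ _
        rw [← ENNReal.ofReal_ofNat 2, ← ENNReal.ofReal_inv_of_pos (by norm_num)]
        exact ENNReal.ofReal_le_ofReal (by norm_num)

theorem volume_rectangle (J : Set ℝ) (β : ℂ) (h : ℝ) :
    volume {z : ℂ | z.re ∈ J ∧ |(z + β).im| ≤ h} = volume J * ENNReal.ofReal (2 * h) := by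
  have h1 : {z : ℂ | z.re ∈ J ∧ |(z + β).im| ≤ h} = Complex.measurableEquivRealProd ⁻¹'
      (J ×ˢ Set.Icc (-β.im - h) (-β.im + h)) := by
    ext z
    simp only [Set.mem_ofPred_eq, Set.mem_preimage, Complex.measurableEquivRealProd_apply,
      Set.mem_prod, Set.mem_Icc, Complex.add_im, abs_le]
    refine and_congr_right fun _ => ⟨fun h => ⟨?_, ?_⟩, fun h => ⟨?_, ?_⟩⟩ <;> linarith [h.1, h.2]
  rw [h1, Complex.volume_preserving_equiv_real_prod.measure_preimage_equiv, Measure.volume_eq_prod,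
    Measure.prod_prod, Real.volume_Icc]
  congr 2; ring

/-- In the slice with index `n` the low region has area of order `√(n + 10⁴)`, so its reference
measure is bounded by a sum of terms of order `(n + 10⁴)^(-3/2)`. -/
theorem farMeasure_lowRegion_le {β : ℂ} {K : ℝ} (hβ : ‖β‖ ≤ K) :
    farMeasure K (lowRegion β) ≤ ENNReal.ofReal (3 / 10) := by
  have hslice : ∀ n : ℕ, volume (lowRegion β ∩ farRegion K ∩ unitSlice n) ≤
      ENNReal.ofReal (3 / 5 * √((n : ℝ) + 10 ^ 4)) := by
    intro n
    set N : ℝ := (n : ℝ) + 10 ^ 4 with hN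
    have hsub : lowRegion β ∩ farRegion K ∩ unitSlice n ⊆
        {z : ℂ | z.re ∈ Set.Ico (n : ℝ) (n + 1) ∧ |(z + β).im| ≤ 3 / 20 * √N} ∪
        {z : ℂ | z.re ∈ Set.Ioc (-n - 1 : ℝ) (-n) ∧ |(z + β).im| ≤ 3 / 20 * √N} := by
      rintro z ⟨⟨hlow, hfar⟩, hn⟩
      have hlow' : |(z + β).im| ≤ √‖z‖ / 10 := hlow
      have hsqrt : √‖z‖ ≤ ‖z‖ / 100 := by
        rw [Real.sqrt_le_left (by positivity)]
        nlinarith [hfar.1]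
      -- A low far point is close to the horizontal direction, so `|z|` is controlled by `|re z|`.
      have him : |z.im| ≤ |(z + β).im| + ‖β‖ := by
        have h1 : z.im = (z + β).im - β.im := by simp
        rw [h1]
        exact (abs_sub _ _).trans (by gcongr; exact Complex.abs_im_le_norm β)
      have hnorm := Complex.norm_le_abs_re_add_abs_im z
      have hle : ‖z‖ ≤ (3 / 2) ^ 2 * N := by
        linarith [hn.2, hfar.2, hfar.1]
      have hh : |(z + β).im| ≤ 3 / 20 * √N := by
        have := Real.sqrt_le_sqrt hle
        rw [Real.sqrt_mul (by positivity), Real.sqrt_sq (by norm_num)] at this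
        linarith
      exact (unitSlice_subset n hn).imp (fun h => ⟨h, hh⟩) (fun h => ⟨h, hh⟩)
    refine (measure_mono hsub).trans ((measure_union_le _ _).trans (le_of_eq ?_))
    rw [volume_rectangle, volume_rectangle, Real.volume_Ico, Real.volume_Ioc,
      ← ENNReal.ofReal_mul (by linarith), ← ENNReal.ofReal_mul (by linarith),
      ← ENNReal.ofReal_add (by ring_nf; positivity) (by ring_nf; positivity)]
    ring_nf
  calc farMeasure K (lowRegion β) ≤ _ := farMeasure_le_tsum K (measurableSet_lowRegion β)
    _ ≤ ∑' n : ℕ, ENNReal.ofReal 10 *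
          ENNReal.ofReal (1 / (((n : ℝ) + 10 ^ 4) * √((n : ℝ) + 10 ^ 4))) := by
        refine ENNReal.tsum_le_tsum fun n => (mul_le_mul_right (hslice n) _).trans ?_
        rw [← ENNReal.ofReal_mul (by positivity), ← ENNReal.ofReal_mul (by positivity)]
        apply ENNReal.ofReal_le_ofReal
        have hN : (10 : ℝ) ^ 4 ≤ n + 10 ^ 4 := by simp
        generalize (n : ℝ) + 10 ^ 4 = N at hN
        have hs2 : √N ^ 2 = N := Real.sq_sqrt (by linarith)
        have hs : 0 < √N := Real.sqrt_pos.2 (by linarith)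
        calc 16 / N ^ 2 * (3 / 5 * √N) = 48 / 5 * √N / N ^ 2 := by ring
          _ ≤ 10 * √N / N ^ 2 := by gcongr; norm_num
          _ = 10 * (1 / (N * √N)) := by
            have : 0 < N := by linarith
            field_simp
            rw [hs2]
    _ ≤ ENNReal.ofReal 10 * ENNReal.ofReal (3 / 100) := by
        rw [ENNReal.tsum_mul_left]
        exact mul_le_mul_right tsum_one_div_mul_sqrt_le _
    _ = _ := by
        rw [← ENNReal.ofReal_mul (by positivity)]
        norm_num

/-! ### Points whose orbit becomes low -/

/-- The points `z` with `z, f z, …, fⁿ z` high and `fⁿ⁺¹ z` low, where `f = sineMap α β`. -/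
def descentSet (α β : ℂ) (x : ℝ) : ℕ → Set ℂ
  | 0 => highRegion β x ∩ sineMap α β ⁻¹' lowRegion β
  | n + 1 => highRegion β x ∩ sineMap α β ⁻¹' descentSet α β x n

theorem measurableSet_descentSet (α β : ℂ) (x : ℝ) (n : ℕ) :
    MeasurableSet (descentSet α β x n) := by
  induction n with
  | zero =>
    exact (measurableSet_highRegion β x).inter
      (measurableSet_preimage_sineMap α β (measurableSet_lowRegion β))
  | succ n ih =>
    exact (measurableSet_highRegion β x).inter (measurableSet_preimage_sineMap α β ih)

theorem farMeasure_descentSet_le {α β : ℂ} {K x : ℝ} (h : IsSteepHeight α β K x) (n : ℕ) :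
    farMeasure K (descentSet α β x n) ≤ 2⁻¹ ^ (n + 1) * farMeasure K (lowRegion β) := by
  induction n with
  | zero => simpa [descentSet] using farMeasure_inter_preimage_le h (measurableSet_lowRegion β)
  | succ n ih =>
    refine (farMeasure_inter_preimage_le h (measurableSet_descentSet α β x n)).trans ?_
    rw [pow_succ' _ (n + 1), mul_assoc]
    exact mul_le_mul_right ih _

theorem volume_inter_descentSet_le {α β : ℂ} {K x : ℝ} (h : IsSteepHeight α β K x) (a : ℝ)
    (n : ℕ) :
    volume ({z : ℂ | z.re ∈ Set.Ico a (a + 2 * Real.pi)} ∩ descentSet α β x n) ≤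
      2⁻¹ ^ n * farMeasure K (lowRegion β) := by
  have hJ : ∀ s ∈ Set.Ico a (a + 2 * Real.pi), ∀ t ∈ Set.Ico a (a + 2 * Real.pi),
      |s - t| < 2 * Real.pi := by
    rintro s ⟨hs, hs'⟩ t ⟨ht, ht'⟩
    rw [abs_lt]
    constructor <;> linarith
  cases n with
  | zero => simpa [descentSet] using volume_inter_preimage_le h measurableSet_Ico hJ (measurableSet_lowRegion β)
  | succ n => exact (volume_inter_preimage_le h measurableSet_Ico hJ
      (measurableSet_descentSet α β x n)).trans (farMeasure_descentSet_le h n)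

theorem volume_inter_iUnion_descentSet_le {α β : ℂ} {K x : ℝ} (h : IsSteepHeight α β K x)
    (a : ℝ) :
    volume ({z : ℂ | z.re ∈ Set.Ico a (a + 2 * Real.pi)} ∩ ⋃ n, descentSet α β x n) ≤
      ENNReal.ofReal (3 / 5) := by
  rw [Set.inter_iUnion]
  calc _ ≤ ∑' n, volume ({z : ℂ | z.re ∈ Set.Ico a (a + 2 * Real.pi)} ∩ descentSet α β x n) :=
        measure_iUnion_le _
    _ ≤ ∑' n : ℕ, 2⁻¹ ^ n * farMeasure K (lowRegion β) :=
        ENNReal.tsum_le_tsum fun n => volume_inter_descentSet_le h a n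
    _ = 2 * farMeasure K (lowRegion β) := by
        rw [ENNReal.tsum_mul_right, ENNReal.tsum_geometric_two]
    _ ≤ 2 * ENNReal.ofReal (3 / 10) :=
        mul_le_mul_right (farMeasure_lowRegion_le h.norm_shift_le) _
    _ = _ := by
        rw [← ENNReal.ofReal_ofNat 2, ← ENNReal.ofReal_mul (by norm_num)]
        norm_num

/-! ### Orbits that never become low escape fast -/

theorem norm_sin_le_exp_norm (w : ℂ) : ‖Complex.sin w‖ ≤ Real.exp ‖w‖ := by
  have h1 : ‖Complex.exp (-w * Complex.I)‖ ≤ Real.exp ‖w‖ := by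
    refine (Complex.norm_exp_le_exp_norm _).trans_eq ?_
    simp
  have h2 : ‖Complex.exp (w * Complex.I)‖ ≤ Real.exp ‖w‖ := by
    refine (Complex.norm_exp_le_exp_norm _).trans_eq ?_
    simp
  have h3 : ‖Complex.sin w‖ =
      ‖Complex.exp (-w * Complex.I) - Complex.exp (w * Complex.I)‖ / 2 := by
    simp [Complex.sin]
  rw [h3]
  linarith [norm_sub_le (Complex.exp (-w * Complex.I)) (Complex.exp (w * Complex.I))]

theorem maxModulus_sineMap_le (α β : ℂ) (r : ℝ) :
    maxModulus (sineMap α β) r ≤ ‖α‖ * Real.exp ‖β‖ * Real.exp r := by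
  refine Real.sSup_le ?_ (by positivity)
  rintro _ ⟨z, hz, rfl⟩
  have hz' : ‖z‖ = r := by simpa using hz
  change ‖sineMap α β z‖ ≤ _
  rw [sineMap, norm_mul, mul_assoc, ← Real.exp_add]
  gcongr
  refine (norm_sin_le_exp_norm _).trans (Real.exp_le_exp.2 ?_)
  linarith [norm_add_le z β]

theorem sineMap_mem_highRegion_diff {α β : ℂ} {K x : ℝ} (h : IsSteepHeight α β K x) {z : ℂ}
    (hz : z ∈ highRegion β x \ ⋃ n, descentSet α β x n) :
    sineMap α β z ∉ lowRegion β ∧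
      sineMap α β z ∈ highRegion β x \ ⋃ n, descentSet α β x n := by
  have hD : ∀ n, z ∉ descentSet α β x n := fun n hn => hz.2 (Set.mem_iUnion.2 ⟨n, hn⟩)
  have hlow : sineMap α β z ∉ lowRegion β := fun hl => hD 0 ⟨hz.1, hl⟩
  refine ⟨hlow, h.sineMap_mem_highRegion hz.1 hlow, fun hmem => ?_⟩
  obtain ⟨n, hn⟩ := Set.mem_iUnion.1 hmem
  exact hD (n + 1) ⟨hz.1, hn⟩

/-- A high point whose orbit never becomes low is fast escaping.  Its heights `t n` satisfy
`t (n + 1) ≥ 10 exp (t n / 4)`, and `t / 8` dominates the iterates of `r ↦ ‖α‖ exp (‖β‖ + r)`,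
which bound those of the maximal modulus, from some time on. -/
theorem mem_fastEscapingSet_sineMap {α β : ℂ} {K x : ℝ} (h : IsSteepHeight α β K x) {z : ℂ}
    (hz : z ∈ highRegion β x \ ⋃ n, descentSet α β x n) {R : ℝ} (hR : 0 < R) :
    z ∈ fastEscapingSet (sineMap α β) R := by
  set f := sineMap α β with hf
  have horbit : ∀ n, f^[n] z ∈ highRegion β x \ ⋃ n, descentSet α β x n := by
    intro n
    induction n with
    | zero => exact hz
    | succ n ih =>
      rw [Function.iterate_succ_apply']
      exact (sineMap_mem_highRegion_diff h ih).2
  set t : ℕ → ℝ := fun n => |(f^[n] z + β).im| with ht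
  have ht0 : ∀ n, 0 ≤ t n := fun n => abs_nonneg _
  have hrise : ∀ n, 10 * Real.exp (t n / 4) ≤ t (n + 1) := by
    intro n
    simp only [ht, Function.iterate_succ_apply']
    exact h.exp_le_height_of_notMem_lowRegion (horbit n).1 (sineMap_mem_highRegion_diff h (horbit n)).1
  have hlin : ∀ n : ℕ, (n : ℝ) ≤ t n := by
    intro n
    induction n with
    | zero => simpa using ht0 0
    | succ n ih =>
      have := Real.add_one_le_exp (t n / 4)
      push_cast
      linarith [hrise n, ht0 n]
  have hnorm : ∀ n, t (n + 1) / 8 ≤ ‖f^[n + 1] z‖ := by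
    intro n
    have hfar : f^[n + 1] z ∈ farRegion K := by
      rw [Function.iterate_succ_apply']
      exact h.sineMap_mem_farRegion (horbit n).1
    have h1 : t (n + 1) ≤ 2 * ‖f^[n + 1] z‖ := h.height_le_norm hfar
    linarith [norm_nonneg (f^[n + 1] z)]
  obtain ⟨l, hl⟩ := exists_nat_ge (max (8 * R) (8 * (‖α‖ * Real.exp ‖β‖)))
  have hl1 : 8 * R ≤ l := (le_max_left _ _).trans hl
  have hl2 : 8 * (‖α‖ * Real.exp ‖β‖) ≤ l := (le_max_right _ _).trans hl
  obtain ⟨m, rfl⟩ : ∃ m, l = m + 1 := by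
    refine Nat.exists_eq_succ_of_ne_zero fun h0 => ?_
    rw [h0] at hl1
    push_cast at hl1
    linarith
  have hmain : ∀ n, (maxModulus f)^[n] R ≤ t (n + (m + 1)) / 8 := by
    intro n
    induction n with
    | zero =>
      have := hlin (0 + (m + 1))
      rw [zero_add] at this ⊢
      rw [Function.iterate_zero_apply]
      linarith
    | succ n ih =>
      rw [Function.iterate_succ_apply', show n + 1 + (m + 1) = n + (m + 1) + 1 by ring]
      have hk := hlin (n + (m + 1))
      have hk' := hrise (n + (m + 1))
      have hA : ‖α‖ * Real.exp ‖β‖ ≤ t (n + (m + 1)) / 8 := by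
        push_cast at hk hl2
        linarith [Nat.cast_nonneg (α := ℝ) n]
      generalize n + (m + 1) = k at ih hA hk'
      have hsq : Real.exp (t k / 4) = Real.exp (t k / 8) * Real.exp (t k / 8) := by
        rw [← Real.exp_add]
        ring_nf
      -- One factor `exp (t k / 8)` absorbs the constant `‖α‖ exp ‖β‖`, the other one
      -- carries the comparison of `M` with the exponential.
      calc maxModulus f ((maxModulus f)^[n] R)
          ≤ ‖α‖ * Real.exp ‖β‖ * Real.exp ((maxModulus f)^[n] R) := maxModulus_sineMap_le α β _
        _ ≤ Real.exp (t k / 8) * Real.exp (t k / 8) := by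
            gcongr
            linarith [Real.add_one_le_exp (t k / 8)]
        _ ≤ t (k + 1) / 8 := by linarith [Real.exp_pos (t k / 4)]
  refine ⟨m + 1, fun n => (hmain n).trans ?_⟩
  exact hnorm (n + m)

/-! ### Area of the complement of the fast escaping set -/

/-- The term `4πx` is the area of the central rectangle, the rest is the area of the high points
whose orbit becomes low.  The closed strip is covered by two half-open ones, on which the map has
the required injectivity, which only doubles that area. -/
theorem volume_verticalStrip_inter_compl_le {α β : ℂ} {K x : ℝ} (h : IsSteepHeight α β K x) {R : ℝ}
    (hR : 0 < R) (a : ℝ) :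
    volume (verticalStrip a ∩ (fastEscapingSet (sineMap α β) R)ᶜ) ≤
      ENNReal.ofReal (4 * Real.pi * x + 6 / 5) := by
  have hpi := Real.pi_pos
  have hx := h.one_le
  have hsub : verticalStrip a ∩ (fastEscapingSet (sineMap α β) R)ᶜ ⊆
      {z : ℂ | z.re ∈ Set.Icc a (a + 2 * Real.pi) ∧ |(z + β).im| ≤ x} ∪
      (({z : ℂ | z.re ∈ Set.Ico a (a + 2 * Real.pi)} ∩ ⋃ n, descentSet α β x n) ∪
      ({z : ℂ | z.re ∈ Set.Ico (a + 2 * Real.pi) (a + 2 * Real.pi + 2 * Real.pi)} ∩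
        ⋃ n, descentSet α β x n)) := by
    rintro z ⟨⟨hz1, hz2⟩, hz⟩
    by_cases hhigh : z ∈ highRegion β x
    · have hD : z ∈ ⋃ n, descentSet α β x n := by
        by_contra hD
        exact hz (mem_fastEscapingSet_sineMap h ⟨hhigh, hD⟩ hR)
      rcases hz2.lt_or_eq with hlt | heq
      · exact Or.inr (Or.inl ⟨⟨hz1, hlt⟩, hD⟩)
      · exact Or.inr (Or.inr ⟨⟨heq.ge, by rw [heq]; linarith⟩, hD⟩)
    · exact Or.inl ⟨⟨hz1, hz2⟩, not_lt.1 hhigh⟩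
  refine (measure_mono hsub).trans ((measure_union_le _ _).trans ((add_le_add le_rfl
    ((measure_union_le _ _).trans (add_le_add (volume_inter_iUnion_descentSet_le h a)
      (volume_inter_iUnion_descentSet_le h (a + 2 * Real.pi))))).trans (le_of_eq ?_)))
  rw [volume_rectangle, Real.volume_Icc, ← ENNReal.ofReal_mul (by linarith),
    ← ENNReal.ofReal_add (by norm_num) (by norm_num),
    ← ENNReal.ofReal_add (by ring_nf; positivity) (by norm_num)]
  ring_nf

theorem two_pow_le_exp_nat (n : ℕ) : (2 : ℝ) ^ n ≤ Real.exp n := by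
  have h1 : (2 : ℝ) ≤ Real.exp 1 := by linarith [Real.add_one_le_exp 1]
  calc (2 : ℝ) ^ n ≤ Real.exp 1 ^ n := by gcongr
    _ = Real.exp n := by rw [← Real.exp_nat_mul, mul_one]

/-- The lower bound `12 + 2 log c` for `x` gives `exp (x / 2) ≥ e⁶ c` with `c ≥ 536 √2 / ‖α‖`, which
yields the expansion; the bound by `log (1 + 18 K / ‖α‖)` makes the values dominate the
parameters. -/
theorem isSteepHeight_of_le {α β : ℂ} (hα : α ≠ 0) {x : ℝ}
    (h1 : Real.log (1 + 18 * max (‖α‖ / 2) ‖β‖ / ‖α‖) ≤ x) (h2 : 6 * Real.log 2 ≤ x)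
    (h3 : 12 + 2 * Real.log (536 * √2 / ‖α‖ + 1 / ‖α‖ ^ 2) ≤ x) :
    IsSteepHeight α β (max (‖α‖ / 2) ‖β‖) x := by
  have hpos : 0 < ‖α‖ := norm_pos_iff.2 hα
  have hK : 0 ≤ max (‖α‖ / 2) ‖β‖ := (norm_nonneg β).trans (le_max_right _ _)
  refine ⟨by linarith [Real.log_two_gt_d9], by linarith [le_max_left (‖α‖ / 2) ‖β‖],
    le_max_right _ _, ?_, ?_⟩
  · set c := 536 * √2 / ‖α‖ + 1 / ‖α‖ ^ 2 with hc
    have hcpos : 0 < c := by positivity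
    have hc1 : 536 * √2 ≤ ‖α‖ * c := by
      have : ‖α‖ * c = 536 * √2 + 1 / ‖α‖ := by rw [hc]; field_simp
      rw [this]
      linarith [one_div_pos.2 hpos]
    have hexp : Real.exp 6 * c ≤ Real.exp (x / 2) := by
      rw [← Real.exp_log hcpos, ← Real.exp_add]
      exact Real.exp_le_exp.2 (by linarith)
    have hs : (1.4 : ℝ) ≤ √2 := Real.le_sqrt_of_sq_le (by norm_num)
    have h64 : (2 : ℝ) ^ 6 ≤ Real.exp 6 := by exact_mod_cast two_pow_le_exp_nat 6
    calc (4 : ℝ) * 10 ^ 4 ≤ 2 ^ 6 * (536 * 1.4) := by norm_num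
      _ ≤ Real.exp 6 * (‖α‖ * c) := by
          refine mul_le_mul h64 (le_trans ?_ hc1) (by norm_num) (Real.exp_pos 6).le
          gcongr
      _ = ‖α‖ * (Real.exp 6 * c) := by ring
      _ ≤ _ := by gcongr
  · have h4 := (Real.log_le_iff_le_exp (by positivity)).1 h1
    have h5 : 18 * max (‖α‖ / 2) ‖β‖ / ‖α‖ ≤ Real.exp x - 1 := by linarith
    rw [div_le_iff₀ hpos] at h5
    linarith

theorem isSteepHeight_twentyFour {β : ℂ} (hβ : ‖β‖ ≤ 2) : IsSteepHeight 1 β 2 24 := by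
  have h1 : (2.7 : ℝ) ≤ Real.exp 1 := by linarith [Real.exp_one_gt_d9]
  have h12 : (2.7 : ℝ) ^ 12 ≤ Real.exp 12 := by
    calc (2.7 : ℝ) ^ 12 ≤ Real.exp 1 ^ 12 := by gcongr
      _ = Real.exp 12 := by rw [← Real.exp_nat_mul]; norm_num
  refine ⟨by norm_num, by norm_num, hβ, ?_, ?_⟩
  · rw [norm_one, one_mul, show (24 : ℝ) / 2 = 12 by norm_num]
    refine le_trans ?_ h12
    norm_num
  · have := Real.add_one_le_exp 24
    have h24 : Real.exp 12 ≤ Real.exp 24 := Real.exp_le_exp.2 (by norm_num)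
    rw [norm_one, one_mul]
    norm_num at h12
    linarith

/-- For `‖β‖ ≤ 2` and `α = 1` the height `24` is already steep, and `96 π + 6 / 5 < 361`. -/
theorem volume_verticalStrip_inter_compl_lt {β : ℂ} (hβ : ‖β‖ ≤ 2) {R : ℝ} (hR : 0 < R) (a : ℝ) :
    volume (verticalStrip a ∩ (fastEscapingSet (sineMap 1 β) R)ᶜ) < 361 := by
  refine (volume_verticalStrip_inter_compl_le (isSteepHeight_twentyFour hβ) hR a).trans_lt ?_
  rw [← ENNReal.ofReal_ofNat 361, ENNReal.ofReal_lt_ofReal_iff (by norm_num)]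
  linarith [Real.pi_lt_d2]

theorem theorem1p2 :
    (∀ (α β : ℂ), α ≠ 0 → ∀ (K r c x : ℝ),
      K = max (‖α‖ / 2) ‖β‖ →
      r = 1 / 8 →
      c = 536 * Real.sqrt 2 / ‖α‖ + 1 / ‖α‖ ^ 2 →
      x = max (Real.log (1 + 18 * K / ‖α‖))
            (max (Real.log (8 * (K + 1) / ‖α‖))
              (max (6 * Real.log 2) (12 + 2 * Real.log c))) →
      ∀ R : ℝ, IsAdmissibleRadius (fun z => α * Complex.sin (z + β)) R → ∀ a : ℝ,
        volume (verticalStrip a ∩ (fastEscapingSet (fun z => α * Complex.sin (z + β)) R)ᶜ) ≤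
          ENNReal.ofReal ((4 * Real.pi + 4 * r) *
            (x + r + 8 * c * Real.exp (4 - x / 2) * (r / (1 - Real.exp (-r / 2)))))) ∧
    (∀ R : ℝ, IsAdmissibleRadius Complex.sin R → ∀ a : ℝ,
      volume (verticalStrip a ∩ (fastEscapingSet Complex.sin R)ᶜ) < 361) ∧
    (∀ R : ℝ, IsAdmissibleRadius Complex.cos R → ∀ a : ℝ,
      volume (verticalStrip a ∩ (fastEscapingSet Complex.cos R)ᶜ) < 361) := by
  refine ⟨?_, fun R hR a => ?_, fun R hR a => ?_⟩
  · rintro α β hα K r c x rfl rfl rfl hx R hR a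
    have hx1 := le_max_left (Real.log (1 + 18 * max (‖α‖ / 2) ‖β‖ / ‖α‖))
      (max (Real.log (8 * (max (‖α‖ / 2) ‖β‖ + 1) / ‖α‖))
        (max (6 * Real.log 2) (12 + 2 * Real.log (536 * √2 / ‖α‖ + 1 / ‖α‖ ^ 2))))
    have hx2 : max (6 * Real.log 2) (12 + 2 * Real.log (536 * √2 / ‖α‖ + 1 / ‖α‖ ^ 2)) ≤ x :=
      hx ▸ (le_max_right _ _).trans (le_max_right _ _)
    rw [← hx] at hx1
    have hsteep : IsSteepHeight α β (max (‖α‖ / 2) ‖β‖) x :=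
      isSteepHeight_of_le hα hx1 ((le_max_left _ _).trans hx2) ((le_max_right _ _).trans hx2)
    refine (volume_verticalStrip_inter_compl_le hsteep hR.1 a).trans (ENNReal.ofReal_le_ofReal ?_)
    have hlast : 0 ≤ 8 * (536 * √2 / ‖α‖ + 1 / ‖α‖ ^ 2) * Real.exp (4 - x / 2) *
        (1 / 8 / (1 - Real.exp (-(1 / 8) / 2))) := by
      have : Real.exp (-(1 / 8) / 2) ≤ 1 := Real.exp_le_one_iff.2 (by norm_num)
      have : 0 ≤ 1 - Real.exp (-(1 / 8) / 2) := by linarith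
      positivity
    have hx0 := hsteep.one_le
    have hpi := Real.pi_gt_three
    calc 4 * Real.pi * x + 6 / 5 ≤ (4 * Real.pi + 4 * (1 / 8)) * (x + 1 / 8) := by nlinarith
      _ ≤ _ := by
        refine mul_le_mul_of_nonneg_left ?_ (by positivity)
        linarith
  · have hsin : Complex.sin = sineMap 1 0 := by
      ext z
      simp [sineMap]
    rw [hsin]
    exact volume_verticalStrip_inter_compl_lt (by simp) hR.1 a
  · have hcos : Complex.cos = sineMap 1 (Real.pi / 2) := by
      ext z
      simp [sineMap, Complex.sin_add_pi_div_two]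
    rw [hcos]
    refine volume_verticalStrip_inter_compl_lt ?_ hR.1 a
    rw [norm_div, Complex.norm_real, Real.norm_eq_abs, abs_of_pos Real.pi_pos]
    simp only [Complex.norm_ofNat]
    linarith [Real.pi_lt_d2]
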